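/- Let $K\subset\mathbb{R}^d$ be compact and convex, let $\mathsf X\subseteq\mathbb{R}^d$ be an open set with $K\subseteq\mathsf X$, and let $F:\mathsf X\to\mathcal P(\mathbb{R}^d)$ be a set-valued map. Let $(x_k)_{k\ge 0}$ be a $K$-projected perturbed approximate discretization of $F$: for every $k\ge 1$, \[ x_k=\Pi_K\bigl(x_{k-1}+\gamma_k\{v_k+e_k+r_k\}\bigr),\qquad v_k\in F(y_k), \] where $\Pi_K$ is the Euclidean projection onto $K$. Assume: (A1) for every $x\in\mathsf X$ the set $F(x)$ is nonempty, convex and compact; $F$ is upper hemicontinuous, i.e. for every $x\in\mathsf X$ and every open $U\supseteq F(x)$ there is an open neighbourhood $V\subseteq\mathsf X$ of $x$ with $\bigcup_{z\in V}F(z)\subseteq U$; and $\bigcup_{x\in C}F(x)$ is bounded for every compact $C\subset\mathsf X$; (A2) $\gamma_k>0$ for all $k\ge1$, $\sum_{k\ge 1}\gamma_k=\infty$ and $\gamma_k\to0$; (A3) $\|r_k\|\to0$ and the series $\sum_{k\ge1}\gamma_k e_k$ converges; (A4) $y_k\in\mathsf X$ for all $k\ge1$ and $\|x_k-y_k\|\to0$.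 Assume moreover that $\sup_{k\ge1}\|e_k\|<\infty$. Put $t_0=0$, $t_k=\gamma_1+\dots+\gamma_k$, and let $X_0:\mathbb{R}\to\mathbb{R}^d$ be the piecewise linear interpolation \[ X_0(t)=x_0\ \ (t\le0),\qquad X_0(t)=\frac{t-t_{k-1}}{\gamma_k}\,x_k+\frac{t_k-t}{\gamma_k}\,x_{k-1}\ \ (t\in[t_{k-1},t_k],\ k\ge1). \] Let $(s_k)_{k\ge1}$ be a nondecreasing sequence of positive reals with $s_k\to\infty$, and let $X_k(t)=X_0(t+s_k)$ for $t\ge0$, $k\ge1$. Then: (i) The family $(X_k)_{k\ge1}$ is precompact in the topology of compact convergence on $[0,\infty)$; in particular, for every increasing sequence $(n_j)$ of positive integers there are a subsequence $(\tilde n_j)$ and a continuous $X_\infty:[0,\infty)\to\mathbb{R}^d$ such that $\sup_{t\in[0,T]}\|X_{\tilde n_j}(t)-X_\infty(t)\|\to0$ for every $T>0$. (ii) Whenever a subsequence of $(X_k)_{k\ge1}$ converges, uniformly on compact subsets of $[0,\infty)$, to a function $X_\infty$, the limit is a solution of the projected differential inclusion \[ \dot x\in\Pi_{T_K(x)}(F(x)),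 \] i.e. $X_\infty(t)\in K$ for all $t\ge0$, $X_\infty$ is absolutely continuous on compact intervals, and for almost every $t\ge0$ the derivative $\dot X_\infty(t)$ exists and belongs to $\Pi_{T_K(X_\infty(t))}(F(X_\infty(t)))$. Here, for $x\in K$, $T_K(x)=\mathrm{cl}\{d\in\mathbb{R}^d:\exists\,\epsilon>0,\ x+\epsilon d\in K\}$ is the tangent cone and, for a closed convex set $C$ and a set $A$, $\Pi_C(A)=\{\Pi_C(a):a\in A\}$. -/

import Mathlib

open Filter Topology Set
open scoped UniformConvergence

noncomputable section

namespace PPAD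

section Metric

variable {E : Type*} [NormedAddCommGroup E] [NormedSpace ℝ E]

/-- `p` is a (for closed convex `C`: the) projection of `a` onto `C`. -/
def IsProj (C : Set E) (a p : E) : Prop :=
  p ∈ C ∧ ∀ z ∈ C, dist a p ≤ dist a z

/-- The projection `Π_C(A) = {Π_C(a) : a ∈ A}` of a set `A` onto `C`. -/
def projSet (C A : Set E) : Set E :=
  {p | ∃ a ∈ A, IsProj C a p}

/-- The tangent cone `T_K(x)`: the closure of the set of feasible directions of `K` at `x`. -/
def tangentCone (K : Set E) (x : E) : Set E :=
  closure {d | ∃ ε : ℝ, 0 < ε ∧ x + ε • d ∈ K}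

/-- Upper hemicontinuity at `x` of a set-valued map with domain `X`
(only the values of `F` on `X` matter). -/
def UpperHemicontinuousAt (X : Set E) (F : E → Set E) (x : E) : Prop :=
  (F x).Nonempty ∧
    ∀ U : Set E, IsOpen U → F x ⊆ U →
      ∃ V : Set E, IsOpen V ∧ x ∈ V ∧ V ⊆ X ∧ (⋃ z ∈ V, F z) ⊆ U

/-- Standing assumption on the field: `X` is open and `F` is upper hemicontinuous,
convex-compact valued and locally bounded on `X`. -/
structure FieldAssumption (X : Set E) (F : E → Set E) : Prop where
  isOpen : IsOpen X
  upperHemicontinuous : ∀ x ∈ X, UpperHemicontinuousAt X F x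
  convex : ∀ x ∈ X, Convex ℝ (F x)
  compact : ∀ x ∈ X, IsCompact (F x)
  locallyBounded : ∀ C : Set E, IsCompact C → C ⊆ X → Bornology.IsBounded (⋃ x ∈ C, F x)

/-- The times `t_k = γ_1 + ⋯ + γ_k`, with `t_0 = 0`. -/
def time (γ : ℕ → ℝ) (k : ℕ) : ℝ := ∑ i ∈ Finset.Icc 1 k, γ i

/-- Standing assumption on the step sizes `γ_k`, `k ≥ 1`. -/
structure StepAssumption (γ : ℕ → ℝ) : Prop where
  pos : ∀ k, 1 ≤ k → 0 < γ k
  sum_eq_top : Tendsto (fun n => ∑ k ∈ Finset.Icc 1 n, γ k) atTop atTop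
  tendsto_zero : Tendsto γ atTop (𝓝 0)

/-- Standing assumption on the two parts of the noise `η_k = e_k + r_k`, `k ≥ 1`; the series
`∑ γ_k e_k` converges in the sense of its partial sums. -/
structure NoiseAssumption (γ : ℕ → ℝ) (e r : ℕ → E) : Prop where
  tendsto_r : Tendsto (fun k => ‖r k‖) atTop (𝓝 0)
  series_e : ∃ S : E, Tendsto (fun n => ∑ k ∈ Finset.Icc 1 n, γ k • e k) atTop (𝓝 S)

/-- Standing assumption on the approximation sequence `y_k`, `k ≥ 1`. -/
structure ApproxAssumption (X : Set E) (x y : ℕ → E) : Prop where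
  mem : ∀ k, 1 ≤ k → y k ∈ X
  tendsto : Tendsto (fun k => ‖x k - y k‖) atTop (𝓝 0)

/-- The projected recursion `x_k = Π_K(x_{k-1} + γ_k (v_k + e_k + r_k))` with `v_k ∈ F(y_k)`,
for every `k ≥ 1`. -/
def IsPPAD (K : Set E) (F : E → Set E) (γ : ℕ → ℝ) (x y v e r : ℕ → E) : Prop :=
  ∀ k, 1 ≤ k → v k ∈ F (y k) ∧
    IsProj K (x (k - 1) + γ k • (v k + e k + r k)) (x k)

/-- The piecewise linear interpolation `X_0` of `x` with nodes `t_k`. For `t > 0` the index `k` is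
the least one with `t ≤ t_k`, so that `t ∈ (t_{k-1}, t_k]`; see `interp_of_mem_Icc`. -/
def interp (γ : ℕ → ℝ) (x : ℕ → E) (t : ℝ) : E :=
  if t ≤ 0 then x 0
  else
    let k := sInf {k : ℕ | t ≤ time γ k}
    ((t - time γ (k - 1)) / γ k) • x k + ((time γ k - t) / γ k) • x (k - 1)

theorem interp_of_nonpos (γ : ℕ → ℝ) (x : ℕ → E) {t : ℝ} (ht : t ≤ 0) :
    interp γ x t = x 0 := if_pos ht

theorem time_pred_add (γ : ℕ → ℝ) {k : ℕ} (hk : 1 ≤ k) :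
    time γ k = time γ (k - 1) + γ k := by
  obtain ⟨m, rfl⟩ : ∃ m, k = m + 1 := ⟨k - 1, by omega⟩
  simp [time, Finset.sum_Icc_succ_top]

theorem time_mono {γ : ℕ → ℝ} (hγ : ∀ k, 1 ≤ k → 0 < γ k) : Monotone (time γ) := by
  refine monotone_nat_of_le_succ fun n => ?_
  have h := time_pred_add γ (Nat.succ_le_succ (Nat.zero_le n))
  have := hγ (n + 1) (by omega)
  simp only [Nat.succ_eq_add_one, Nat.add_sub_cancel] at h
  linarith

/-- On every `[t_{k-1}, t_k]`, `k ≥ 1`, the interpolation is given by the expected formula. -/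
theorem interp_of_mem_Icc {γ : ℕ → ℝ} (hγ : ∀ k, 1 ≤ k → 0 < γ k) (x : ℕ → E) {k : ℕ}
    (hk : 1 ≤ k) {t : ℝ} (ht : t ∈ Set.Icc (time γ (k - 1)) (time γ k)) :
    interp γ x t =
      ((t - time γ (k - 1)) / γ k) • x k + ((time γ k - t) / γ k) • x (k - 1) := by
  have hγk := hγ k hk
  have hstep := time_pred_add γ hk
  have h0 : time γ 0 = 0 := by simp [time]
  have key : ∀ j, 1 ≤ j → time γ (j - 1) < t → t ≤ time γ j →
      sInf {i : ℕ | t ≤ time γ i} = j := by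
    intro j hj h1 h2
    refine le_antisymm (Nat.sInf_le h2) ?_
    refine le_csInf ⟨j, h2⟩ fun i hi => ?_
    by_contra hlt
    have := time_mono hγ (show i ≤ j - 1 by omega)
    have hi' : t ≤ time γ i := hi
    linarith
  rcases ht.1.eq_or_lt with heq | hlt
  · have e1 : (t - time γ (k - 1)) / γ k = 0 := by rw [← heq]; simp
    have e2 : (time γ k - t) / γ k = 1 := by
      rw [← heq, hstep]; field_simp; ring
    rw [e1, e2, zero_smul, one_smul, zero_add]
    by_cases hk1 : k = 1
    · subst hk1
      refine interp_of_nonpos γ x ?_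
      rw [← heq]; simp [h0]
    · have hg := hγ (k - 1) (by omega)
      have hs := time_pred_add γ (show 1 ≤ k - 1 by omega)
      have hm := time_mono hγ (Nat.zero_le (k - 1 - 1))
      have hpos : ¬ t ≤ 0 := by rw [h0] at hm; linarith
      have hidx := key (k - 1) (by omega) (by linarith) heq.ge
      simp only [interp, if_neg hpos, hidx]
      have f1 : (t - time γ (k - 1 - 1)) / γ (k - 1) = 1 := by
        rw [← heq, hs]; field_simp; ring
      have f2 : (time γ (k - 1) - t) / γ (k - 1) = 0 := by rw [← heq]; simp
      rw [f1, f2, one_smul, zero_smul, add_zero]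
  · have hm := time_mono hγ (Nat.zero_le (k - 1))
    have hpos : ¬ t ≤ 0 := by rw [h0] at hm; linarith
    simp only [interp, if_neg hpos, key k hk hlt ht.2]

/-- The shifted interpolation `X_k(t) = X_0(t + s_k)`. -/
def shifted (γ s : ℕ → ℝ) (x : ℕ → E) (k : ℕ) (t : ℝ) : E :=
  interp γ x (t + s k)

/-- Solutions on `[0, ∞)` of the projected differential inclusion `ẋ ∈ Π_{T_K(x)}(F(x))`: curves
with values in `K`, absolutely continuous on compact intervals, satisfying the inclusion almost
everywhere. -/
structure IsProjectedSolution (K : Set E) (F : E → Set E) (z : ℝ → E) : Prop where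
  mem : ∀ t, 0 ≤ t → z t ∈ K
  absolutelyContinuous : ∀ T, 0 < T → AbsolutelyContinuousOnInterval z 0 T
  inclusion : ∀ᵐ t ∂(MeasureTheory.volume : MeasureTheory.Measure ℝ), 0 ≤ t →
    ∃ w : E, HasDerivAt z w t ∧ w ∈ projSet (tangentCone K (z t)) (F (z t))

/-- Relative compactness of the family `f_k`, `k ≥ 1`, of functions on `[0, ∞)` in the topology of
uniform convergence on compact sets. -/
def PrecompactCompactConvergence (f : ℕ → ℝ → E) : Prop :=
  IsCompact (closure
    ((fun k => UniformOnFun.ofFun {C : Set (Set.Ici (0 : ℝ)) | IsCompact C}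
        (fun t : Set.Ici (0 : ℝ) => f k t)) '' Set.Ici 1))

/-- The sequence `f_j` converges to `g` uniformly on every `[0, T]`. -/
def TendstoCompactly (f : ℕ → ℝ → E) (g : ℝ → E) : Prop :=
  ∀ T : ℝ, 0 < T → TendstoUniformlyOn f g atTop (Set.Icc 0 T)

end Metric

end PPAD

end

/-!
Since `K` is compact, the field is locally bounded and the noise is bounded, the drifts
`w_k = v_k + e_k + r_k` are bounded, so the increments of `x` are at most `L * γ_k` and the interpolation is `L`-Lipschitz
(`IsPPAD.exists_norm_sub_le`, `lipschitzWith_interp`). Its translates form an equi-Lipschitz family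
with values in a fixed ball, and precompactness is the Arzelà–Ascoli theorem
(`isCompact_setOf_lipschitzWith`).

A limit `z` of translates is Lipschitz with values in `K`, hence differentiable at almost every
`t > 0`. No weak compactness of the derivatives is needed: the inclusion is checked at each such `t`
by averaging the recursion over a short time interval `[t, t + h]`. The projection step says that
`w_i - u_i`, with `u_i = (x_i - x_{i-1}) / γ_i`, is an outward normal vector of `K` at `x_i`, that is
`⟪w_i - u_i, q - x_i⟫ ≤ 0` for all `q ∈ K`. Averaging these inequalities and replacing `x_i` by the
nearby point `z t` costs `O(h)` (`inner_sum_sub_le`). In the limit along the sequence of translates the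
noise averages out (`tendsto_sum_noise`), the average of the `u_i` becomes the difference quotient of
`z`, and the average of the `v_i` is close to the convex set `F (z t)` by upper hemicontinuity. Letting
`h → 0` and using compactness of `F (z t)` gives `f ∈ F (z t)` with `⟪f - z' t, q - z t⟫ ≤ 0` for all
`q ∈ K` (`exists_mem_inner_le`, `exists_mem_inner_le_zero`).

So `f - z' t` is normal to `K` at `z t`, whereas both `z' t` and `-z' t` are tangent, because `z`
stays in `K` on both sides of `t`. Hence `f - z' t` is orthogonal to `z' t`, which makes `z' t` the
projection of `f` onto the tangent cone (`isProj_tangentCone_of_hasDerivAt`).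
-/

namespace PPAD

/-! ### Sums over blocks of steps -/

section Sequences

variable {E : Type*} [NormedAddCommGroup E]

theorem exists_norm_le_of_eventually {u : ℕ → E} {M : ℝ} (h : ∀ᶠ k in atTop, ‖u k‖ ≤ M) :
    ∃ M', ∀ k, ‖u k‖ ≤ M' := by
  obtain ⟨M', hM'⟩ := Filter.IsBoundedUnder.bddAbove_range (f := fun k => ‖u k‖)
    ⟨M, by simpa using h⟩
  exact ⟨M', fun k => hM' ⟨k, rfl⟩⟩

theorem sum_Ioc_sub_pred (x : ℕ → E) {m n : ℕ} (hmn : m ≤ n) :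
    ∑ i ∈ Finset.Ioc m n, (x i - x (i - 1)) = x n - x m := by
  induction n, hmn using Nat.le_induction with
  | base => simp
  | succ n hmn ih => rw [Finset.sum_Ioc_succ_top (by omega), ih]; simp

theorem time_zero (γ : ℕ → ℝ) : time γ 0 = 0 := by simp [time]

theorem time_succ (γ : ℕ → ℝ) (k : ℕ) : time γ (k + 1) = time γ k + γ (k + 1) := by
  simpa using time_pred_add γ (k := k + 1) (by omega)

theorem time_sub_time (γ : ℕ → ℝ) {m n : ℕ} (hmn : m ≤ n) :
    time γ n - time γ m = ∑ i ∈ Finset.Ioc m n, γ i := by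
  induction n, hmn using Nat.le_induction with
  | base => simp
  | succ n hmn ih => rw [Finset.sum_Ioc_succ_top (by omega), ← ih, time_succ]; ring

theorem norm_sub_le_time_sub
    {γ : ℕ → ℝ} {x : ℕ → E} {L : ℝ}
    (hL : ∀ k, 1 ≤ k → ‖x k - x (k - 1)‖ ≤ L * γ k) {m n : ℕ} (hmn : m ≤ n) :
    ‖x n - x m‖ ≤ L * (time γ n - time γ m) := by
  rw [← sum_Ioc_sub_pred x hmn, time_sub_time γ hmn, Finset.mul_sum]
  exact norm_sum_le_of_le _ fun i hi => hL i (by have := Finset.mem_Ioc.1 hi; omega)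

end Sequences

/-! ### Piecewise linear interpolation -/

section Interpolation

variable {E : Type*} [NormedAddCommGroup E] [NormedSpace ℝ E]
  {γ : ℕ → ℝ} {x : ℕ → E} {L : ℝ} {C : Set E} {N : ℕ}

/-- Every nonnegative time lies in one of the half-open step intervals. -/
theorem exists_time_le_lt (hγ : StepAssumption γ) {τ : ℝ} (hτ : 0 ≤ τ) :
    ∃ m, time γ m ≤ τ ∧ τ < time γ (m + 1) := by
  have hex : ∃ n, τ < time γ n := (hγ.sum_eq_top.eventually_gt_atTop τ).exists
  classical
  have h0 : Nat.find hex ≠ 0 := fun h => by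
    have := Nat.find_spec hex
    rw [h, time_zero] at this
    linarith
  obtain ⟨m, hm⟩ := Nat.exists_eq_succ_of_ne_zero h0
  have hs := Nat.find_spec hex
  rw [hm] at hs
  exact ⟨m, not_lt.1 (Nat.find_min hex (by omega)), hs⟩

theorem interp_of_mem_Icc_succ (hγ : StepAssumption γ) (x : ℕ → E) {m : ℕ} {τ : ℝ}
    (h₁ : time γ m ≤ τ) (h₂ : τ ≤ time γ (m + 1)) :
    interp γ x τ = ((τ - time γ m) / γ (m + 1)) • x (m + 1)
      + ((time γ (m + 1) - τ) / γ (m + 1)) • x m := by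
  simpa using interp_of_mem_Icc hγ.pos x (k := m + 1) (by omega) (t := τ) ⟨h₁, h₂⟩

theorem interp_time (hγ : StepAssumption γ) (x : ℕ → E) (m : ℕ) :
    interp γ x (time γ m) = x m := by
  have hp := hγ.pos (m + 1) (by omega)
  have hs := time_succ γ m
  rw [interp_of_mem_Icc_succ hγ x le_rfl (by linarith), hs]
  simp [hp.ne']

/-- If all the nodes from the index `N` on lie in a convex set, so does the interpolation from the
time `t_N` on. -/
theorem interp_mem (hγ : StepAssumption γ) (hC : Convex ℝ C) (hx : ∀ k, N ≤ k → x k ∈ C)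
    {τ : ℝ} (hτ : time γ N ≤ τ) : interp γ x τ ∈ C := by
  have h0 : 0 ≤ τ := by
    have := time_mono hγ.pos (Nat.zero_le N)
    rw [time_zero] at this
    linarith
  obtain ⟨m, h₁, h₂⟩ := exists_time_le_lt hγ h0
  have hN : N ≤ m := by
    by_contra h
    have := time_mono hγ.pos (show m + 1 ≤ N by omega)
    linarith
  have hp := hγ.pos (m + 1) (by omega)
  rw [interp_of_mem_Icc_succ hγ x h₁ h₂.le]
  refine hC (hx _ (by omega)) (hx _ hN) (div_nonneg (by linarith) hp.le)
    (div_nonneg (by linarith) hp.le) ?_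
  rw [← add_div, div_eq_one_iff_eq hp.ne', time_succ]
  ring

/-- On a single step interval the interpolation is affine with slope `(x_{m+1} - x_m) / γ_{m+1}`. -/
theorem norm_interp_sub_le_of_mem_Icc (hγ : StepAssumption γ)
    (hL : ∀ k, 1 ≤ k → ‖x k - x (k - 1)‖ ≤ L * γ k) {m : ℕ} {a b : ℝ}
    (ha : time γ m ≤ a) (hab : a ≤ b) (hb : b ≤ time γ (m + 1)) :
    ‖interp γ x b - interp γ x a‖ ≤ L * (b - a) := by
  have hp := hγ.pos (m + 1) (by omega)
  have hm := hL (m + 1) (by omega)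
  rw [interp_of_mem_Icc_succ hγ x (ha.trans hab) hb, interp_of_mem_Icc_succ hγ x ha (hab.trans hb)]
  have : ((b - time γ m) / γ (m + 1)) • x (m + 1) + ((time γ (m + 1) - b) / γ (m + 1)) • x m
      - (((a - time γ m) / γ (m + 1)) • x (m + 1) + ((time γ (m + 1) - a) / γ (m + 1)) • x m)
      = ((b - a) / γ (m + 1)) • (x (m + 1) - x m) := by
    module
  rw [this, norm_smul, Real.norm_of_nonneg (div_nonneg (by linarith) hp.le)]
  calc (b - a) / γ (m + 1) * ‖x (m + 1) - x m‖
      ≤ (b - a) / γ (m + 1) * (L * γ (m + 1)) := by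
        refine mul_le_mul_of_nonneg_left (by simpa using hm) (div_nonneg (by linarith) hp.le)
    _ = L * (b - a) := by field_simp

theorem norm_interp_sub_le (hγ : StepAssumption γ) (hL0 : 0 ≤ L)
    (hL : ∀ k, 1 ≤ k → ‖x k - x (k - 1)‖ ≤ L * γ k) {a b : ℝ} (hab : a ≤ b) :
    ‖interp γ x b - interp γ x a‖ ≤ L * (b - a) := by
  have key : ∀ n, ∀ a b : ℝ, a ≤ b → b ≤ time γ n →
      ‖interp γ x b - interp γ x a‖ ≤ L * (b - a) := by
    intro n
    induction n with
    | zero =>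
      intro a b hab hb
      rw [time_zero] at hb
      rw [interp_of_nonpos γ x hb, interp_of_nonpos γ x (hab.trans hb), sub_self, norm_zero]
      exact mul_nonneg hL0 (by linarith)
    | succ n ih =>
      intro a b hab hb
      rcases le_total b (time γ n) with h | h
      · exact ih a b hab h
      rcases le_total (time γ n) a with h' | h'
      · exact norm_interp_sub_le_of_mem_Icc hγ hL h' hab hb
      · have h₁ := norm_interp_sub_le_of_mem_Icc hγ hL le_rfl h hb
        have h₂ := ih a (time γ n) h' le_rfl
        have h₃ := norm_sub_le_norm_sub_add_norm_sub (interp γ x b) (interp γ x (time γ n))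
          (interp γ x a)
        linarith
  obtain ⟨n, hn⟩ := (hγ.sum_eq_top.eventually_ge_atTop b).exists
  exact key n a b hab hn

theorem lipschitzWith_interp (hγ : StepAssumption γ) (hL0 : 0 ≤ L)
    (hL : ∀ k, 1 ≤ k → ‖x k - x (k - 1)‖ ≤ L * γ k) :
    LipschitzWith L.toNNReal (interp γ x) := by
  refine LipschitzWith.of_dist_le_mul fun a b => ?_
  rw [Real.coe_toNNReal _ hL0]
  rcases le_total a b with h | h
  · rw [dist_comm, dist_comm a, dist_eq_norm, Real.dist_eq, abs_of_nonneg (by linarith)]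
    exact norm_interp_sub_le hγ hL0 hL h
  · rw [dist_eq_norm, Real.dist_eq, abs_of_nonneg (by linarith)]
    exact norm_interp_sub_le hγ hL0 hL h

end Interpolation

/-! ### Precompactness of equi-Lipschitz families -/

section Compactness

variable {E : Type*} [NormedAddCommGroup E] {L : NNReal} {Q : Set E} {f : ℕ → ℝ → E}

/-- A form of the Arzelà–Ascoli theorem: `L`-Lipschitz functions with values in a compact set form
a compact set in the topology of compact convergence. -/
theorem isCompact_setOf_lipschitzWith (L : NNReal) (hQ : IsCompact Q) :
    IsCompact {g : C(Ici (0 : ℝ), E) | LipschitzWith L g ∧ ∀ t, g t ∈ Q} := by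
  apply ArzelaAscoli.isCompact_of_equicontinuous
  · have himg : ContinuousMap.toFun '' {g : C(Ici (0 : ℝ), E) | LipschitzWith L g ∧ ∀ t, g t ∈ Q}
        = {g | LipschitzWith L g} ∩ Set.univ.pi fun _ : Ici (0 : ℝ) => Q := by
      ext g
      constructor
      · rintro ⟨g, ⟨h₁, h₂⟩, rfl⟩
        exact ⟨h₁, fun t _ => h₂ t⟩
      · rintro ⟨h₁, h₂⟩
        exact ⟨⟨g, h₁.continuous⟩, ⟨h₁, fun t => h₂ t trivial⟩, rfl⟩
    rw [himg]
    refine (isCompact_univ_pi fun _ => hQ).inter_left ?_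
    simp only [lipschitzWith_iff_dist_le_mul, Set.ofPred_forall]
    exact isClosed_iInter fun a => isClosed_iInter fun b =>
      isClosed_le ((continuous_apply a).dist (continuous_apply b)) continuous_const
  · exact (LipschitzWith.uniformEquicontinuous _ L fun g => g.2.1).equicontinuous

theorem precompactCompactConvergence_of_lipschitz (hQ : IsCompact Q)
    (hf : ∀ k, LipschitzWith L (f k)) (hfQ : ∀ k t, 0 ≤ t → f k t ∈ Q) :
    PrecompactCompactConvergence f := by
  have hc := (isCompact_setOf_lipschitzWith L hQ).image
    ContinuousMap.isUniformEmbedding_toUniformOnFunIsCompact.uniformContinuous.continuous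
  have : T2Space (Ici (0 : ℝ) →ᵤ[{C | IsCompact C}] E) :=
    UniformOnFun.t2Space_of_covering (eq_univ_of_forall fun t =>
      mem_sUnion_of_mem (mem_singleton t) isCompact_singleton)
  refine hc.closure_of_subset ?_
  rintro _ ⟨k, -, rfl⟩
  exact ⟨⟨fun t => f k t, (hf k).continuous.comp continuous_subtype_val⟩,
    ⟨(hf k).comp (LipschitzWith.subtype_val _) |>.weaken (by simp), fun t => hfQ k t t.2⟩, rfl⟩

theorem exists_tendstoCompactly_of_lipschitz (hQ : IsCompact Q)
    (hf : ∀ k, LipschitzWith L (f k)) (hfQ : ∀ k t, 0 ≤ t → f k t ∈ Q) :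
    ∃ φ : ℕ → ℕ, StrictMono φ ∧ ∃ z : ℝ → E, ContinuousOn z (Ici 0) ∧
      TendstoCompactly (fun j => f (φ j)) z := by
  let g : ℕ → C(Ici (0 : ℝ), E) := fun k =>
    ⟨fun t => f k t, (hf k).continuous.comp continuous_subtype_val⟩
  have : LocallyCompactSpace (Ici (0 : ℝ)) := isClosed_Ici.locallyCompactSpace
  have : FirstCountableTopology C(Ici (0 : ℝ), E) := UniformSpace.firstCountableTopology _
  obtain ⟨g', -, φ, hφ, hlim⟩ := (isCompact_setOf_lipschitzWith L hQ).tendsto_subseq (x := g)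
    fun k => ⟨(hf k).comp (LipschitzWith.subtype_val _) |>.weaken (by simp), fun t => hfQ k t t.2⟩
  refine ⟨φ, hφ, fun t => g' (Set.projIci 0 t),
    (g'.continuous.comp (Continuous.subtype_mk (by fun_prop) _)).continuousOn, fun T _ => ?_⟩
  have h := ContinuousMap.tendsto_iff_forall_isCompact_tendstoUniformlyOn.1 hlim
    (Subtype.val ⁻¹' Icc 0 T)
    (isClosed_Ici.isClosedEmbedding_subtypeVal.isCompact_preimage isCompact_Icc)
  intro U hU
  filter_upwards [h U hU] with j hj t ht
  simpa [g, Set.projIci_of_mem (show t ∈ Ici 0 from ht.1)] using hj ⟨t, ht.1⟩ ht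

end Compactness

/-! ### Projections, tangent cones and normal vectors -/

section Projection

variable {E : Type*} [NormedAddCommGroup E] [InnerProductSpace ℝ E] {K : Set E}

theorem IsProj.inner_le_zero (hK : Convex ℝ K) {a p : E} (h : IsProj K a p) {q : E} (hq : q ∈ K) :
    inner ℝ (a - p) (q - p) ≤ 0 := by
  have : Nonempty K := ⟨⟨p, h.1⟩⟩
  refine (norm_eq_iInf_iff_real_inner_le_zero hK h.1).1 (le_antisymm ?_ ?_) q hq
  · exact le_ciInf fun w => by simpa [dist_eq_norm] using h.2 w w.2
  · exact ciInf_le (f := fun w : K => ‖a - w‖) ⟨0, by rintro _ ⟨w, rfl⟩; exact norm_nonneg _⟩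
      ⟨p, h.1⟩

theorem isProj_of_inner_le_zero {a p : E} (hp : p ∈ K)
    (h : ∀ q ∈ K, inner ℝ (a - p) (q - p) ≤ 0) : IsProj K a p := by
  refine ⟨hp, fun q hq => ?_⟩
  rw [dist_eq_norm, dist_eq_norm]
  refine le_of_sq_le_sq ?_ (norm_nonneg _)
  have h₁ : a - q = (a - p) - (q - p) := by abel
  rw [h₁, norm_sub_sq_real (a - p) (q - p)]
  nlinarith [h q hq, sq_nonneg ‖q - p‖]

/-- A vector of the normal cone makes an obtuse angle with every tangent vector. -/
theorem inner_le_zero_of_mem_tangentCone {p w d : E} (hw : ∀ q ∈ K, inner ℝ w (q - p) ≤ 0)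
    (hd : d ∈ tangentCone K p) : inner ℝ w d ≤ 0 := by
  have hcl : IsClosed {d : E | inner ℝ w d ≤ 0} :=
    isClosed_le (continuous_const.inner continuous_id) continuous_const
  refine closure_minimal ?_ hcl hd
  rintro d ⟨ε, hε, hm⟩
  have := hw _ hm
  rw [add_sub_cancel_left, inner_smul_right] at this
  exact nonpos_of_mul_nonpos_right this hε

/-- The right derivative of a curve in `K` is tangent to `K`. -/
theorem mem_tangentCone_of_hasDerivAt {z : ℝ → E} {z' : E} {t : ℝ} (hz : ∀ᶠ τ in 𝓝 t, z τ ∈ K)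
    (hd : HasDerivAt z z' t) : z' ∈ tangentCone K (z t) := by
  refine mem_closure_of_tendsto ((hasDerivWithinAt_iff_tendsto_slope' self_notMem_Ioi).1
    (hd.hasDerivWithinAt (s := Ioi t))) ?_
  have hle : 𝓝[>] t ≤ 𝓝 t := nhdsWithin_le_nhds
  filter_upwards [hle hz, self_mem_nhdsWithin] with τ hτ hτ'
  have hpos : 0 < τ - t := sub_pos.2 hτ'
  refine ⟨τ - t, hpos, ?_⟩
  rw [slope_def_module, smul_smul, mul_inv_cancel₀ hpos.ne', one_smul]
  simpa using hτ

/-- The left derivative of a curve in `K` is the negative of a tangent vector of `K`. -/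
theorem neg_mem_tangentCone_of_hasDerivAt {z : ℝ → E} {z' : E} {t : ℝ}
    (hz : ∀ᶠ τ in 𝓝 t, z τ ∈ K) (hd : HasDerivAt z z' t) : -z' ∈ tangentCone K (z t) := by
  have hd' : HasDerivAt (fun τ => z (-τ)) (-z') (-t) := by
    have h : HasDerivAt z z' (- -t) := by rwa [neg_neg]
    simpa [Function.comp_def] using h.scomp (-t) (hasDerivAt_neg (-t))
  have hz' : ∀ᶠ τ in 𝓝 (-t), z (-τ) ∈ K := by
    have : Tendsto (fun τ : ℝ => -τ) (𝓝 (-t)) (𝓝 t) := by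
      simpa using (continuous_neg (G := ℝ)).tendsto (-t)
    exact this.eventually hz
  simpa using mem_tangentCone_of_hasDerivAt hz' hd'

/-- If `v` differs from the velocity `z'` of a curve in `K` by a normal vector, then `z'` is the
projection of `v` onto the tangent cone: since both `z'` and `-z'` are tangent, the normal vector
`v - z'` is orthogonal to `z'`. -/
theorem isProj_tangentCone_of_hasDerivAt {z : ℝ → E} {z' v : E} {t : ℝ}
    (hz : ∀ᶠ τ in 𝓝 t, z τ ∈ K) (hd : HasDerivAt z z' t)
    (hv : ∀ q ∈ K, inner ℝ (v - z') (q - z t) ≤ 0) : IsProj (tangentCone K (z t)) v z' := by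
  refine isProj_of_inner_le_zero (mem_tangentCone_of_hasDerivAt hz hd) fun d hd' => ?_
  have h₁ := inner_le_zero_of_mem_tangentCone hv hd'
  have h₂ := inner_le_zero_of_mem_tangentCone hv (neg_mem_tangentCone_of_hasDerivAt hz hd)
  rw [inner_neg_right] at h₂
  rw [inner_sub_right]
  linarith

end Projection

/-! ### Estimates for the recursion -/

section Recursion

variable {E : Type*} [NormedAddCommGroup E] [InnerProductSpace ℝ E]
  {X K : Set E} {F : E → Set E} {γ : ℕ → ℝ} {x y v e r : ℕ → E}

theorem IsPPAD.mem (hx : IsPPAD K F γ x y v e r) {k : ℕ} (hk : 1 ≤ k) : x k ∈ K :=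
  (hx k hk).2.1

/-- The part of the drift removed by the projection is normal to `K` at `x_k`. -/
theorem IsPPAD.inner_le_zero (hx : IsPPAD K F γ x y v e r) (hK : Convex ℝ K) {k : ℕ}
    (hk : 1 ≤ k) {q : E} (hq : q ∈ K) :
    inner ℝ (γ k • (v k + e k + r k) - (x k - x (k - 1))) (q - x k) ≤ 0 := by
  have h := (hx k hk).2.inner_le_zero hK hq
  rwa [show x (k - 1) + γ k • (v k + e k + r k) - x k
    = γ k • (v k + e k + r k) - (x k - x (k - 1)) by abel] at h

theorem IsPPAD.exists_norm_v_le [ProperSpace E] (hx : IsPPAD K F γ x y v e r) (hK : IsCompact K)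
    (hKX : K ⊆ X) (hF : FieldAssumption X F) (hy : ApproxAssumption X x y) :
    ∃ M, ∀ k, ‖v k‖ ≤ M := by
  obtain ⟨δ, hδ, hδX⟩ := hK.exists_cthickening_subset_open hF.isOpen hKX
  obtain ⟨M, hM⟩ := (hF.locallyBounded _ hK.cthickening hδX).exists_norm_le
  refine exists_norm_le_of_eventually (M := M) ?_
  filter_upwards [hy.tendsto.eventually_le_const hδ, eventually_ge_atTop 1] with k hk hk1
  refine hM _ (mem_biUnion (Metric.mem_cthickening_of_dist_le _ (x k) _ _ (hx.mem hk1) ?_)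
    (hx k hk1).1)
  rwa [dist_comm, dist_eq_norm]

theorem IsPPAD.exists_norm_drift_le [ProperSpace E] (hx : IsPPAD K F γ x y v e r)
    (hK : IsCompact K) (hKX : K ⊆ X) (hF : FieldAssumption X F) (hη : NoiseAssumption γ e r)
    (hy : ApproxAssumption X x y) (he : ∃ M : ℝ, ∀ k, 1 ≤ k → ‖e k‖ ≤ M) :
    ∃ W, ∀ k, 1 ≤ k → ‖v k + e k + r k‖ ≤ W := by
  obtain ⟨M₁, h₁⟩ := hx.exists_norm_v_le hK hKX hF hy
  obtain ⟨M₂, h₂⟩ := he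
  obtain ⟨M₃, h₃⟩ := exists_norm_le_of_eventually (hη.tendsto_r.eventually_le_const one_pos)
  exact ⟨M₁ + M₂ + M₃, fun k hk =>
    norm_add₃_le.trans (add_le_add (add_le_add (h₁ k) (h₂ k hk)) (h₃ k))⟩

/-- The increments of the recursion are at most proportional to the step sizes. The first increment
plays a special role, as `x 0` need not belong to `K`. -/
theorem IsPPAD.exists_norm_sub_le (hx : IsPPAD K F γ x y v e r) (hγ : StepAssumption γ) {W : ℝ}
    (hW : ∀ k, 1 ≤ k → ‖v k + e k + r k‖ ≤ W) :
    ∃ L, 0 ≤ L ∧ ∀ k, 1 ≤ k → ‖x k - x (k - 1)‖ ≤ L * γ k := by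
  have hW0 : 0 ≤ W := (norm_nonneg _).trans (hW 1 le_rfl)
  refine ⟨max (2 * W) (‖x 1 - x 0‖ / γ 1), le_max_of_le_left (by positivity), fun k hk => ?_⟩
  have hp := hγ.pos k hk
  rcases hk.eq_or_lt with rfl | hk2
  · calc ‖x 1 - x (1 - 1)‖ = ‖x 1 - x 0‖ / γ 1 * γ 1 := by field_simp
      _ ≤ _ := mul_le_mul_of_nonneg_right (le_max_right _ _) hp.le
  · have h := (hx k hk).2.2 _ (hx.mem (k := k - 1) (by omega))
    rw [dist_eq_norm, dist_eq_norm, add_sub_cancel_left, norm_smul, Real.norm_of_nonneg hp.le] at h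
    have h₁ : x k - x (k - 1) = γ k • (v k + e k + r k)
        - (x (k - 1) + γ k • (v k + e k + r k) - x k) := by abel
    have h₂ : γ k * ‖v k + e k + r k‖ ≤ γ k * W := mul_le_mul_of_nonneg_left (hW k hk) hp.le
    calc ‖x k - x (k - 1)‖
        ≤ ‖γ k • (v k + e k + r k)‖ + ‖x (k - 1) + γ k • (v k + e k + r k) - x k‖ := by
          rw [h₁]; exact norm_sub_le _ _
      _ ≤ γ k * W + γ k * W := by
          rw [norm_smul, Real.norm_of_nonneg hp.le]
          exact add_le_add h₂ (h.trans h₂)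
      _ = 2 * W * γ k := by ring
      _ ≤ _ := mul_le_mul_of_nonneg_right (le_max_left _ _) hp.le

/-- Summation of the variational inequalities over a block of steps during which the iterates stay
within `ρ` of `p`: freezing the base point at `p` costs at most `C * ρ` per unit of time. -/
theorem inner_sum_sub_le {w : ℕ → E} {m n : ℕ} (hmn : m ≤ n) {p q : E} {C ρ : ℝ}
    (hC : ∀ i ∈ Finset.Ioc m n, ‖γ i • w i - (x i - x (i - 1))‖ ≤ C * γ i)
    (hin : ∀ i ∈ Finset.Ioc m n, inner ℝ (γ i • w i - (x i - x (i - 1))) (q - x i) ≤ 0)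
    (hρ : ∀ i ∈ Finset.Ioc m n, ‖x i - p‖ ≤ ρ) :
    inner ℝ (∑ i ∈ Finset.Ioc m n, γ i • w i - (x n - x m)) (q - p)
      ≤ C * ρ * (time γ n - time γ m) := by
  rw [← sum_Ioc_sub_pred x hmn, ← Finset.sum_sub_distrib, sum_inner, time_sub_time γ hmn,
    Finset.mul_sum]
  refine Finset.sum_le_sum fun i hi => ?_
  have h₁ : q - p = (q - x i) + (x i - p) := by abel
  rw [h₁, inner_add_right]
  have h₂ := real_inner_le_norm (γ i • w i - (x i - x (i - 1))) (x i - p)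
  have h₃ := mul_le_mul (hC i hi) (hρ i hi) (norm_nonneg _) ((norm_nonneg _).trans (hC i hi))
  linarith [hin i hi]

end Recursion

/-! ### The limit inclusion -/

section Limit

variable {E : Type*} [NormedAddCommGroup E] [InnerProductSpace ℝ E]
  {X K : Set E} {F : E → Set E} {γ : ℕ → ℝ} {x y v e r : ℕ → E}

/-- A time at the left end of the step interval containing `τ_j → ∞` belongs to an index tending to
infinity, and is asymptotically equal to `τ_j`. -/
theorem tendsto_time_index (hγ : StepAssumption γ) {τ : ℕ → ℝ} (hτ : Tendsto τ atTop atTop)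
    {m : ℕ → ℕ} (h₁ : ∀ j, time γ (m j) ≤ τ j) (h₂ : ∀ j, τ j < time γ (m j + 1)) :
    Tendsto m atTop atTop ∧ Tendsto (fun j => τ j - time γ (m j)) atTop (𝓝 0) := by
  have hm : Tendsto m atTop atTop := by
    refine tendsto_atTop.2 fun N => ?_
    filter_upwards [hτ.eventually_ge_atTop (time γ N)] with j hj
    by_contra h
    have := time_mono hγ.pos (show m j + 1 ≤ N by omega)
    linarith [h₂ j]
  refine ⟨hm, squeeze_zero (fun j => sub_nonneg.2 (h₁ j)) (fun j => ?_)
    (hγ.tendsto_zero.comp ((tendsto_add_atTop_nat 1).comp hm))⟩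
  have := h₂ j
  rw [time_succ] at this
  change τ j - time γ (m j) ≤ γ (m j + 1)
  linarith

/-- The noise averages out over blocks of steps of bounded total length. -/
theorem tendsto_sum_noise (hγ : StepAssumption γ) (hη : NoiseAssumption γ e r) {m n : ℕ → ℕ}
    (hmn : ∀ j, m j ≤ n j) (hm : Tendsto m atTop atTop) {h : ℝ}
    (hT : Tendsto (fun j => time γ (n j) - time γ (m j)) atTop (𝓝 h)) :
    Tendsto (fun j => ∑ i ∈ Finset.Ioc (m j) (n j), γ i • (e i + r i)) atTop (𝓝 0) := by
  have hn : Tendsto n atTop atTop := tendsto_atTop_mono hmn hm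
  have hsplit : ∀ j, ∑ i ∈ Finset.Ioc (m j) (n j), γ i • (e i + r i)
      = (∑ i ∈ Finset.Icc 1 (n j), γ i • e i - ∑ i ∈ Finset.Icc 1 (m j), γ i • e i)
        + ∑ i ∈ Finset.Ioc (m j) (n j), γ i • r i := by
    intro j
    have hIcc : ∀ k, Finset.Icc 1 k = Finset.Ioc 0 k := fun k => by ext; simp; omega
    rw [hIcc, hIcc, ← Finset.sum_Ioc_consecutive _ (Nat.zero_le _) (hmn j), add_sub_cancel_left,
      ← Finset.sum_add_distrib]
    simp
  simp only [hsplit]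
  obtain ⟨S, hS⟩ := hη.series_e
  have he : Tendsto (fun j => ∑ i ∈ Finset.Icc 1 (n j), γ i • e i
      - ∑ i ∈ Finset.Icc 1 (m j), γ i • e i) atTop (𝓝 0) := by
    simpa using (hS.comp hn).sub (hS.comp hm)
  have hr : Tendsto (fun j => ∑ i ∈ Finset.Ioc (m j) (n j), γ i • r i) atTop (𝓝 0) := by
    rw [Metric.tendsto_nhds]
    intro ε hε
    have hlim : Tendsto (fun j => ε / (|h| + 1) * (time γ (n j) - time γ (m j))) atTop
        (𝓝 (ε / (|h| + 1) * h)) := hT.const_mul _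
    have hlt : ε / (|h| + 1) * h < ε := by
      rw [div_mul_eq_mul_div, div_lt_iff₀ (by positivity)]
      exact mul_lt_mul_of_pos_left (by linarith [le_abs_self h]) hε
    obtain ⟨N, hN⟩ := eventually_atTop.1
      (hη.tendsto_r.eventually_le_const (show (0 : ℝ) < ε / (|h| + 1) by positivity))
    filter_upwards [hlim.eventually_lt_const hlt, hm.eventually_ge_atTop N] with j hj hNj
    rw [dist_zero_right]
    refine lt_of_le_of_lt ?_ hj
    rw [time_sub_time γ (hmn j), Finset.mul_sum]
    refine norm_sum_le_of_le _ fun i hi => ?_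
    obtain ⟨hi₁, -⟩ := Finset.mem_Ioc.1 hi
    have hp := hγ.pos i (by omega)
    rw [norm_smul, Real.norm_of_nonneg hp.le, mul_comm]
    exact mul_le_mul_of_nonneg_right (hN i (by omega)) hp.le
  simpa using he.add hr

/-- An approximate form of the limit inclusion. Over a short time `h`, the average of the `v_i` is
close to the convex set `F (z t)` by upper hemicontinuity, the noise averages out, and the average of
the increments is close to the difference quotient of `z`. -/
theorem exists_mem_inner_le (hγ : StepAssumption γ) (hη : NoiseAssumption γ e r)
    (hy : ApproxAssumption X x y) (hF : FieldAssumption X F) {L C : ℝ} (hL0 : 0 ≤ L)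
    (hL : ∀ k, 1 ≤ k → ‖x k - x (k - 1)‖ ≤ L * γ k) (hv : ∀ k, 1 ≤ k → v k ∈ F (y k))
    (hin : ∀ k, 1 ≤ k → ∀ q ∈ K,
      inner ℝ (γ k • (v k + e k + r k) - (x k - x (k - 1))) (q - x k) ≤ 0)
    (hC : ∀ k, 1 ≤ k → ‖γ k • (v k + e k + r k) - (x k - x (k - 1))‖ ≤ C * γ k)
    {σ : ℕ → ℝ} (hσ : Tendsto σ atTop atTop) (hσ0 : ∀ j, 0 ≤ σ j) {z : ℝ → E} {z' : E} {t : ℝ}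
    (hz : ∀ τ, 0 ≤ τ → Tendsto (fun j => interp γ x (τ + σ j)) atTop (𝓝 (z τ))) (ht : 0 ≤ t)
    (hzX : z t ∈ X) (hd : HasDerivAt z z' t) {D : ℝ} (hD : 0 < D)
    (hKD : ∀ q ∈ K, ‖q - z t‖ ≤ D) {ε : ℝ} (hε : 0 < ε) :
    ∃ f ∈ F (z t), ∀ q ∈ K, inner ℝ (f - z') (q - z t) ≤ ε := by
  set ε₁ := ε / (6 * D) with hε₁
  have hε₁0 : 0 < ε₁ := by positivity
  -- a radius `δ` on which `F` stays in the `ε₁`-thickening of `F (z t)`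
  obtain ⟨V, hVo, hzV, -, hVF⟩ := (hF.upperHemicontinuous _ hzX).2
    (Metric.thickening ε₁ (F (z t))) Metric.isOpen_thickening (Metric.self_subset_thickening hε₁0 _)
  obtain ⟨δ, hδ, hδV⟩ := Metric.isOpen_iff.1 hVo _ hzV
  -- a time step `h`, short enough for the iterates to stay close to `z t` and for the difference
  -- quotient of `z` to be close to `z'`
  obtain ⟨h, hh, hhδ, hhC, hslope⟩ : ∃ h : ℝ, 0 < h ∧ (L + 1) * h ≤ δ / 2 ∧
      C * ((L + 1) * h) ≤ ε / 2 ∧ ‖z' - h⁻¹ • (z (t + h) - z t)‖ < ε₁ := by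
    have h₁ : Tendsto (fun h : ℝ => (L + 1) * h) (𝓝[>] 0) (𝓝 0) :=
      (Continuous.tendsto' (by fun_prop) 0 0 (by simp)).mono_left nhdsWithin_le_nhds
    have h₂ : Tendsto (fun h : ℝ => C * ((L + 1) * h)) (𝓝[>] 0) (𝓝 0) :=
      (Continuous.tendsto' (by fun_prop) 0 0 (by simp)).mono_left nhdsWithin_le_nhds
    have h₃ : Tendsto (fun h : ℝ => ‖z' - h⁻¹ • (z (t + h) - z t)‖) (𝓝[>] 0) (𝓝 0) := by
      simpa using (tendsto_const_nhds (x := z')).sub hd.tendsto_slope_zero_right |>.norm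
    exact (((eventually_mem_nhdsWithin : ∀ᶠ h : ℝ in 𝓝[>] 0, h ∈ Ioi 0)).and
      ((h₁.eventually_le_const (half_pos hδ)).and
        ((h₂.eventually_le_const (half_pos hε)).and (h₃.eventually_lt_const hε₁0)))).exists
  -- the blocks of steps covering `[t + σ_j, t + h + σ_j]` asymptotically
  choose m hm₁ hm₂ using fun j => exists_time_le_lt hγ (add_nonneg ht (hσ0 j))
  choose n hn₁ hn₂ using fun j => exists_time_le_lt hγ
    (add_nonneg (add_nonneg ht hh.le) (hσ0 j))
  have hmn : ∀ j, m j ≤ n j := by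
    intro j
    by_contra hlt
    have := time_mono hγ.pos (show n j + 1 ≤ m j by omega)
    linarith [hm₁ j, hn₂ j]
  obtain ⟨hm, hmt⟩ := tendsto_time_index hγ (tendsto_atTop_add_const_left _ t hσ) hm₁ hm₂
  obtain ⟨-, hnt⟩ := tendsto_time_index hγ (tendsto_atTop_add_const_left _ (t + h) hσ) hn₁ hn₂
  have hT : Tendsto (fun j => time γ (n j) - time γ (m j)) atTop (𝓝 h) := by
    have := (hmt.sub hnt).const_add h
    simp only [sub_zero, add_zero] at this
    exact this.congr fun j => by ring
  have hnode : ∀ {k : ℕ → ℕ} {τ : ℝ}, 0 ≤ τ → (∀ j, time γ (k j) ≤ τ + σ j) →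
      Tendsto (fun j => τ + σ j - time γ (k j)) atTop (𝓝 0) →
      Tendsto (fun j => x (k j)) atTop (𝓝 (z τ)) := by
    intro k τ hτ hle hlim
    have h₀ : Tendsto (fun j => interp γ x (τ + σ j) - x (k j)) atTop (𝓝 0) := by
      refine squeeze_zero_norm (fun j => ?_) (by simpa using hlim.const_mul L)
      have := norm_interp_sub_le hγ hL0 hL (hle j)
      rwa [interp_time hγ] at this
    simpa using (hz τ hτ).sub h₀
  have hxm := hnode ht hm₁ hmt
  have hxn := hnode (add_nonneg ht hh.le) hn₁ hnt
  have hnoise := tendsto_sum_noise hγ hη hmn hm hT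
  have herr : Tendsto (fun j => ‖z' + (time γ (n j) - time γ (m j))⁻¹ •
      (∑ i ∈ Finset.Ioc (m j) (n j), γ i • (e i + r i) - (x (n j) - x (m j)))‖) atTop
      (𝓝 ‖z' - h⁻¹ • (z (t + h) - z t)‖) := by
    have := ((tendsto_const_nhds (x := z')).add
      ((hT.inv₀ hh.ne').smul (hnoise.sub (hxn.sub hxm)))).norm
    simpa [sub_eq_add_neg] using this
  have hclose : Tendsto (fun j => L * (time γ (n j) - time γ (m j)) + ‖x (m j) - z t‖) atTop
      (𝓝 (L * h)) := by
    simpa using (hT.const_mul L).add (hxm.sub_const (z t)).norm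
  obtain ⟨N, hN⟩ := eventually_atTop.1 (hy.tendsto.eventually_lt_const (half_pos hδ))
  obtain ⟨j, hj₁, hj₂, hj₃, hj₄⟩ := ((hT.eventually_const_lt hh).and
    ((herr.eventually_lt_const hslope).and
      ((hclose.eventually_lt_const (show L * h < (L + 1) * h by linarith)).and
        (hm.eventually_ge_atTop N)))).exists
  set T := time γ (n j) - time γ (m j) with hTdef
  have hTsum : T = ∑ i ∈ Finset.Ioc (m j) (n j), γ i := time_sub_time γ (hmn j)
  have hpos : ∀ i ∈ Finset.Ioc (m j) (n j), 1 ≤ i ∧ 0 < γ i := fun i hi => by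
    have : 1 ≤ i := by have := Finset.mem_Ioc.1 hi; omega
    exact ⟨this, hγ.pos i this⟩
  have hρ : ∀ i ∈ Finset.Ioc (m j) (n j), ‖x i - z t‖ ≤ (L + 1) * h := by
    intro i hi
    obtain ⟨hi₁, hi₂⟩ := Finset.mem_Ioc.1 hi
    have h₁ := norm_sub_le_time_sub hL hi₁.le
    have h₂ := mul_le_mul_of_nonneg_left
      (sub_le_sub_right (time_mono hγ.pos hi₂) (time γ (m j))) hL0
    linarith [norm_sub_le_norm_sub_add_norm_sub (x i) (x (m j)) (z t)]
  have hvi : ∀ i ∈ Finset.Ioc (m j) (n j), v i ∈ Metric.thickening ε₁ (F (z t)) := by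
    intro i hi
    refine hVF (mem_biUnion (hδV ?_) (hv i (hpos i hi).1))
    have h₁ := hN i (by have := Finset.mem_Ioc.1 hi; omega)
    rw [Metric.mem_ball, dist_eq_norm]
    have h₂ := norm_sub_le_norm_sub_add_norm_sub (y i) (x i) (z t)
    rw [norm_sub_rev (x i)] at h₁
    linarith [hρ i hi]
  -- the average of the `v_i` over the block
  have havg : T⁻¹ • ∑ i ∈ Finset.Ioc (m j) (n j), γ i • v i ∈ Metric.thickening ε₁ (F (z t)) := by
    have := ((hF.convex _ hzX).thickening ε₁).sum_mem (t := Finset.Ioc (m j) (n j))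
      (w := fun i => T⁻¹ * γ i) (z := v)
      (fun i hi => mul_nonneg (inv_nonneg.2 hj₁.le) (hpos i hi).2.le)
      (by rw [← Finset.mul_sum, ← hTsum, inv_mul_cancel₀ hj₁.ne']) hvi
    simpa only [Finset.smul_sum, smul_smul] using this
  obtain ⟨f, hf, hfdist⟩ := Metric.mem_thickening_iff.1 havg
  refine ⟨f, hf, fun q hq => ?_⟩
  have hmain := inner_sum_sub_le (γ := γ) (x := x) (w := fun i => v i + e i + r i) (hmn j)
    (p := z t) (q := q) (fun i hi => hC i (hpos i hi).1) (fun i hi => hin i (hpos i hi).1 q hq) hρ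
  have hsplit : ∑ i ∈ Finset.Ioc (m j) (n j), γ i • (v i + e i + r i)
      = ∑ i ∈ Finset.Ioc (m j) (n j), γ i • v i
        + ∑ i ∈ Finset.Ioc (m j) (n j), γ i • (e i + r i) := by
    rw [← Finset.sum_add_distrib]
    exact Finset.sum_congr rfl fun i _ => by rw [add_assoc, smul_add]
  set A := ∑ i ∈ Finset.Ioc (m j) (n j), γ i • v i
  set B := ∑ i ∈ Finset.Ioc (m j) (n j), γ i • (e i + r i)
  rw [hsplit, ← hTdef] at hmain
  have hscaled : inner ℝ (T⁻¹ • (A + B - (x (n j) - x (m j)))) (q - z t)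
      ≤ C * ((L + 1) * h) := by
    rw [real_inner_smul_left, inv_mul_le_iff₀ hj₁]
    linarith
  have hdecomp : f - z' = (f - T⁻¹ • A) + T⁻¹ • (A + B - (x (n j) - x (m j)))
      - (z' + T⁻¹ • (B - (x (n j) - x (m j)))) := by
    rw [show A + B - (x (n j) - x (m j)) = A + (B - (x (n j) - x (m j))) by abel, smul_add]
    abel
  have hq := hKD q hq
  have h₁ : inner ℝ (f - T⁻¹ • A) (q - z t) ≤ ε₁ * D := by
    refine (real_inner_le_norm _ _).trans (mul_le_mul ?_ hq (norm_nonneg _) hε₁0.le)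
    rw [← dist_eq_norm, dist_comm]
    exact hfdist.le
  have h₂ : -inner ℝ (z' + T⁻¹ • (B - (x (n j) - x (m j)))) (q - z t) ≤ ε₁ * D := by
    rw [← inner_neg_left]
    refine (real_inner_le_norm _ _).trans (mul_le_mul ?_ hq (norm_nonneg _) hε₁0.le)
    rw [norm_neg]
    exact hj₂.le
  have h₃ : ε₁ * D = ε / 6 := by rw [hε₁]; field_simp
  rw [hdecomp, inner_sub_left, inner_add_left]
  linarith

/-- Compactness of the value of the field removes the error in an approximate inclusion. -/
theorem exists_mem_inner_le_zero {A : Set E} (hA : IsCompact A) {z' p : E}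
    (h : ∀ ε : ℝ, 0 < ε → ∃ f ∈ A, ∀ q ∈ K, inner ℝ (f - z') (q - p) ≤ ε) :
    ∃ f ∈ A, ∀ q ∈ K, inner ℝ (f - z') (q - p) ≤ 0 := by
  choose f hf hfq using fun n : ℕ => h (1 / ((n : ℝ) + 1)) (by positivity)
  obtain ⟨a, ha, φ, hφ, hlim⟩ := hA.tendsto_subseq hf
  refine ⟨a, ha, fun q hq => ?_⟩
  refine le_of_tendsto_of_tendsto ((hlim.sub_const z').inner tendsto_const_nhds)
    (tendsto_one_div_add_atTop_nhds_zero_nat.comp hφ.tendsto_atTop) (Eventually.of_forall fun n => ?_)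
  exact hfq (φ n) q hq

end Limit

/-! ### Limit curves are solutions -/

section Solution

variable {E : Type*} [NormedAddCommGroup E] [InnerProductSpace ℝ E]
  {X K : Set E} {F : E → Set E} {γ : ℕ → ℝ} {x y v e r : ℕ → E}

/-- Every locally uniform limit of translates of the interpolation is a solution of the projected
differential inclusion. -/
theorem isProjectedSolution_of_tendstoCompactly [FiniteDimensional ℝ E] (hK : IsCompact K)
    (hKc : Convex ℝ K) (hKX : K ⊆ X)
    (hx : IsPPAD K F γ x y v e r) (hF : FieldAssumption X F) (hγ : StepAssumption γ)
    (hη : NoiseAssumption γ e r) (hy : ApproxAssumption X x y) {L W : ℝ} (hL0 : 0 ≤ L)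
    (hL : ∀ k, 1 ≤ k → ‖x k - x (k - 1)‖ ≤ L * γ k) (hW : ∀ k, 1 ≤ k → ‖v k + e k + r k‖ ≤ W)
    {σ : ℕ → ℝ} (hσ : Tendsto σ atTop atTop) (hσ0 : ∀ j, 0 ≤ σ j) {z : ℝ → E}
    (hz : TendstoCompactly (fun j t => interp γ x (t + σ j)) z) : IsProjectedSolution K F z := by
  have hpt : ∀ τ, 0 ≤ τ → Tendsto (fun j => interp γ x (τ + σ j)) atTop (𝓝 (z τ)) := fun τ hτ =>
    (hz (τ + 1) (by linarith)).tendsto_at ⟨hτ, by linarith⟩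
  have hmem : ∀ τ, 0 ≤ τ → z τ ∈ K := by
    intro τ hτ
    refine hK.isClosed.mem_of_tendsto (hpt τ hτ) ?_
    filter_upwards [hσ.eventually_ge_atTop (time γ 1)] with j hj
    exact interp_mem hγ hKc (N := 1) (fun k hk => hx.mem hk) (by linarith)
  have hlip : LipschitzOnWith L.toNNReal z (Ici 0) := by
    refine LipschitzOnWith.of_dist_le_mul fun a ha b hb => ?_
    refine le_of_tendsto ((hpt a ha).dist (hpt b hb)) (Eventually.of_forall fun j => ?_)
    simpa using (lipschitzWith_interp hγ hL0 hL).dist_le_mul (a + σ j) (b + σ j)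
  refine ⟨hmem, fun T hT => ?_, ?_⟩
  · refine (hlip.mono ?_).absolutelyContinuousOnInterval
    rw [uIcc_of_le hT.le]
    exact Icc_subset_Ici_self
  have hne : ∀ᵐ t ∂(MeasureTheory.volume : MeasureTheory.Measure ℝ), t ≠ 0 := by
    simp [MeasureTheory.ae_iff]
  filter_upwards [hlip.ae_differentiableWithinAt_of_mem_real, hne] with t hdiff hne ht
  have htpos : 0 < t := lt_of_le_of_ne ht hne.symm
  have hd := ((hdiff ht).differentiableAt (Ici_mem_nhds htpos)).hasDerivAt
  have hevK : ∀ᶠ τ in 𝓝 t, z τ ∈ K := by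
    filter_upwards [Ici_mem_nhds htpos] with τ hτ using hmem τ hτ
  obtain ⟨R, hR⟩ := (hK.image (continuous_id.sub continuous_const)).isBounded.exists_norm_le
    (s := (fun q => q - z t) '' K)
  have hKD : ∀ q ∈ K, ‖q - z t‖ ≤ max R 1 := fun q hq =>
    (hR _ (mem_image_of_mem _ hq)).trans (le_max_left _ _)
  have hC : ∀ k, 1 ≤ k →
      ‖γ k • (v k + e k + r k) - (x k - x (k - 1))‖ ≤ (W + L) * γ k := by
    intro k hk
    have hp := hγ.pos k hk
    calc _ ≤ ‖γ k • (v k + e k + r k)‖ + ‖x k - x (k - 1)‖ := norm_sub_le _ _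
      _ ≤ γ k * W + L * γ k := by
        rw [norm_smul, Real.norm_of_nonneg hp.le]
        exact add_le_add (mul_le_mul_of_nonneg_left (hW k hk) hp.le) (hL k hk)
      _ = (W + L) * γ k := by ring
  have hzX := hKX (hmem t ht)
  obtain ⟨f, hf, hfq⟩ := exists_mem_inner_le_zero (K := K) (hF.compact _ hzX) fun ε hε =>
    exists_mem_inner_le hγ hη hy hF hL0 hL (fun k hk => (hx k hk).1)
      (fun k hk q hq => hx.inner_le_zero hKc hk hq) hC hσ hσ0 hpt ht hzX hd
      (lt_max_of_lt_right one_pos) hKD hε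
  exact ⟨_, hd, f, hf, isProj_tangentCone_of_hasDerivAt hevK hd hfq⟩

end Solution

end PPAD

theorem mainTheorem3 (d : ℕ)
    (X K : Set (EuclideanSpace ℝ (Fin d)))
    (F : EuclideanSpace ℝ (Fin d) → Set (EuclideanSpace ℝ (Fin d)))
    (γ s : ℕ → ℝ)
    (x y v e r : ℕ → EuclideanSpace ℝ (Fin d))
    (hK : IsCompact K) (hKc : Convex ℝ K) (hKX : K ⊆ X)
    (hx : PPAD.IsPPAD K F γ x y v e r)
    (hF : PPAD.FieldAssumption X F)
    (hγ : PPAD.StepAssumption γ)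
    (hη : PPAD.NoiseAssumption γ e r)
    (hy : PPAD.ApproxAssumption X x y)
    (he : ∃ M : ℝ, ∀ k, 1 ≤ k → ‖e k‖ ≤ M)
    (hs_pos : ∀ k, 1 ≤ k → 0 < s k)
    (hs_mono : ∀ k, 1 ≤ k → s k ≤ s (k + 1))
    (hs_top : Filter.Tendsto s Filter.atTop Filter.atTop) :
    (PPAD.PrecompactCompactConvergence (PPAD.shifted γ s x) ∧
      ∀ n : ℕ → ℕ, StrictMono n → (∀ j, 1 ≤ n j) →
        ∃ φ : ℕ → ℕ, StrictMono φ ∧ ∃ z : ℝ → EuclideanSpace ℝ (Fin d),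
          ContinuousOn z (Set.Ici 0) ∧
          PPAD.TendstoCompactly (fun j => PPAD.shifted γ s x (n (φ j))) z) ∧
    (∀ n : ℕ → ℕ, StrictMono n → (∀ j, 1 ≤ n j) →
      ∀ z : ℝ → EuclideanSpace ℝ (Fin d),
        PPAD.TendstoCompactly (fun j => PPAD.shifted γ s x (n j)) z →
        PPAD.IsProjectedSolution K F z) := by
  obtain ⟨W, hW⟩ := hx.exists_norm_drift_le hK hKX hF hη hy he
  obtain ⟨L, hL0, hL⟩ := hx.exists_norm_sub_le hγ hW
  obtain ⟨R, hR⟩ : ∃ R, ∀ k, ‖x k‖ ≤ R := by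
    obtain ⟨R, hR⟩ := hK.isBounded.exists_norm_le
    refine PPAD.exists_norm_le_of_eventually (M := R) ?_
    filter_upwards [eventually_ge_atTop 1] with k hk using hR _ (hx.mem hk)
  have hlip : ∀ k, LipschitzWith L.toNNReal (PPAD.shifted γ s x k) := fun k =>
    LipschitzWith.of_dist_le_mul fun a b => by
      simpa [PPAD.shifted] using
        (PPAD.lipschitzWith_interp hγ hL0 hL).dist_le_mul (a + s k) (b + s k)
  have hball : ∀ t, PPAD.interp γ x t ∈ Metric.closedBall 0 R := by
    intro t
    rcases le_total t 0 with ht | ht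
    · rw [PPAD.interp_of_nonpos γ x ht]
      simpa using hR 0
    · exact PPAD.interp_mem hγ (convex_closedBall 0 R) (N := 0) (fun k _ => by simpa using hR k)
        (by rwa [PPAD.time_zero])
  have hQ := isCompact_closedBall (0 : EuclideanSpace ℝ (Fin d)) R
  refine ⟨⟨PPAD.precompactCompactConvergence_of_lipschitz hQ hlip fun k t _ => hball _,
    fun n _ _ => PPAD.exists_tendstoCompactly_of_lipschitz hQ (fun k => hlip (n k))
      fun k t _ => hball _⟩, fun n hn hn1 z hz => ?_⟩
  exact PPAD.isProjectedSolution_of_tendstoCompactly hK hKc hKX hx hF hγ hη hy hL0 hL hW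
    (hs_top.comp hn.tendsto_atTop) (fun j => (hs_pos _ (hn1 j)).le) hz
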